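/- Let $n,r$ be natural numbers, $[r]=\{1,\dots,r\}$, and let $A=(a_{ij})_{1\le i\le n,\,1\le j\le r}$ be a real matrix with non-negative entries which has at least one positive entry in each row and in each column. The Shintani zeta function associated to $A$ is given by the series $$\zeta_A(\boldsymbol s)=\sum_{m_1\ge 1}\cdots\sum_{m_r\ge 1}\ \prod_{i=1}^n (a_{i1}m_1+\cdots+a_{ir}m_r)^{-s_i},\qquad \boldsymbol s=(s_1,\dots,s_n)\in\mathbb C^n.$$ For $j\in[r]$ let $C_j(\boldsymbol\epsilon)=\sum_{i=1}^n a_{ij}\epsilon_i$ be the linear form given by the $j$-th column of $A$, and for $I\subset[r]$ let $C_I=\prod_{j\in I}C_j$ (so $C_\emptyset=1$). For a polynomial $p$ in $n$ variables let $\Delta_p\subset\mathbb R^n$ be its Newton polytope, i.e. the convex hull of the exponents of the monomials that occur in $p$ with a nonzero coefficient, and let $\mathbb R^n_+=\{x\in\mathbb R^n: x_i>0\text{ for all }i\}$. If $$(\operatorname{Re}s_1,\dots,\operatorname{Re}s_n)\in\bigcap_{I\subset[r]}\bigl(\Delta_{C_I}+\mathbb R^n_+\bigr)$$ (Minkowski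 sums), then the series defining $\zeta_A(\boldsymbol s)$ is absolutely convergent. -/

import Mathlib

open scoped Pointwise

noncomputable section

/-- The set `Σ_{n×r}(ℝ_{≥0})` of `n × r` matrices with real non-negative entries and with at least
one positive entry in each row and in each column. -/
def shintaniMatrices (n r : ℕ) : Set (Matrix (Fin n) (Fin r) ℝ) :=
  {A | (∀ i j, 0 ≤ A i j) ∧ (∀ i, ∃ j, 0 < A i j) ∧ (∀ j, ∃ i, 0 < A i j)}

/-- The summand of index `m = (m₁, …, m_r)`, `m_j ≥ 1`, of the Shintani zeta function
`ζ_A(s) = ∑_m ∏_i (a_{i1} m₁ + ⋯ + a_{ir} m_r)^{-s_i}`. -/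
def shintaniTerm {n r : ℕ} (A : Matrix (Fin n) (Fin r) ℝ) (s : Fin n → ℂ)
    (m : Fin r → ℕ+) : ℂ :=
  ∏ i, ((∑ j, A i j * ((m j : ℕ) : ℝ) : ℝ) : ℂ) ^ (-s i)

/-- The linear form `C_j(ε) = ∑_i a_{ij} ε_i` of the `j`-th column of `A`, as a polynomial. -/
def columnForm {n r : ℕ} (A : Matrix (Fin n) (Fin r) ℝ) (j : Fin r) : MvPolynomial (Fin n) ℝ :=
  ∑ i, MvPolynomial.C (A i j) * MvPolynomial.X i

/-- The product `C_I = ∏_{j ∈ I} C_j` (so `C_∅ = 1`). -/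
def columnProduct {n r : ℕ} (A : Matrix (Fin n) (Fin r) ℝ) (I : Finset (Fin r)) :
    MvPolynomial (Fin n) ℝ :=
  ∏ j ∈ I, columnForm A j

/-- The Newton polytope `Δ_p ⊆ ℝⁿ`: the convex hull of the exponents of the monomials that occur
in `p` with a nonzero coefficient. -/
def newtonPolytope {n : ℕ} (p : MvPolynomial (Fin n) ℝ) : Set (Fin n → ℝ) :=
  convexHull ℝ ((fun (α : Fin n →₀ ℕ) (i : Fin n) => (α i : ℝ)) '' (p.support : Set (Fin n →₀ ℕ)))

/-- The open positive orthant `ℝⁿ_+`. -/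
def positiveOrthant (n : ℕ) : Set (Fin n → ℝ) :=
  {x | ∀ i, 0 < x i}

end

/-!
By additivity of Newton polytopes, a point of `Δ_{C_{[r]}}` is a sum `∑ v_j` of points of the
simplices `Δ_{C_j}`, that is, the vector of row sums of a non-negative matrix with column sums `1`
supported where `A` is. Spreading the strictly positive excess along the rows of `A` turns it into
weights `w` with row sums exactly `Re s_i` and column sums greater than `1`. Bounding each linear
form from below by each of its terms `a_{ij} m_j`, with multiplicity `w_{ij}`, dominates the series
by a constant multiple of the product over `j` of the convergent series `∑ m ^ (-∑ i, w_{ij})`.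
-/

theorem newtonPolytope_one (n : ℕ) : newtonPolytope (1 : MvPolynomial (Fin n) ℝ) = 0 := by
  simp [newtonPolytope, MvPolynomial.support_one, ← Pi.zero_def, Set.singleton_zero]

theorem newtonPolytope_mul_subset {n : ℕ} (p q : MvPolynomial (Fin n) ℝ) :
    newtonPolytope (p * q) ⊆ newtonPolytope p + newtonPolytope q := by
  classical
  simp only [newtonPolytope, ← convexHull_add]
  refine convexHull_mono ?_
  rintro _ ⟨α, hα, rfl⟩
  obtain ⟨β, hβ, γ, hγ, rfl⟩ := Finset.mem_add.mp (MvPolynomial.support_mul p q hα)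
  exact ⟨_, ⟨β, hβ, rfl⟩, _, ⟨γ, hγ, rfl⟩, by ext; simp⟩

theorem newtonPolytope_prod_subset {n : ℕ} {κ : Type*} (p : κ → MvPolynomial (Fin n) ℝ)
    (I : Finset κ) : newtonPolytope (∏ j ∈ I, p j) ⊆ ∑ j ∈ I, newtonPolytope (p j) := by
  induction I using Finset.cons_induction with
  | empty => simpa only [Finset.prod_empty, Finset.sum_empty] using (newtonPolytope_one n).subset
  | cons j I hj ih =>
    rw [Finset.prod_cons, Finset.sum_cons]
    exact (newtonPolytope_mul_subset _ _).trans (Set.add_subset_add_left ih)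

/-- The face of the standard simplex spanned by the unit vectors `e_i` with `a_{ij} ≠ 0`, which
contains the Newton polytope of `C_j`. It is given by equations, so that its points can be used
directly as columns of weights. -/
def columnFace {n r : ℕ} (A : Matrix (Fin n) (Fin r) ℝ) (j : Fin r) : Set (Fin n → ℝ) :=
  stdSimplex ℝ (Fin n) ∩ {x | ∀ i, A i j = 0 → x i = 0}

theorem convex_columnFace {n r : ℕ} (A : Matrix (Fin n) (Fin r) ℝ) (j : Fin r) :
    Convex ℝ (columnFace A j) := by
  refine (convex_stdSimplex ℝ _).inter fun x hx y hy a b _ _ _ i hi => ?_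
  simp [hx i hi, hy i hi]

theorem exists_eq_single_of_mem_support_columnForm {n r : ℕ} {A : Matrix (Fin n) (Fin r) ℝ}
    {j : Fin r} {α : Fin n →₀ ℕ} (hα : α ∈ (columnForm A j).support) :
    ∃ i, A i j ≠ 0 ∧ α = Finsupp.single i 1 := by
  classical
  rw [MvPolynomial.mem_support_iff, columnForm, MvPolynomial.coeff_sum] at hα
  obtain ⟨i, -, hi⟩ := Finset.exists_ne_zero_of_sum_ne_zero hα
  rw [MvPolynomial.coeff_C_mul, MvPolynomial.coeff_X, mul_ite, mul_one, mul_zero, ite_ne_right_iff]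
    at hi
  exact ⟨i, hi.2, hi.1.symm⟩

theorem newtonPolytope_columnForm_subset {n r : ℕ} (A : Matrix (Fin n) (Fin r) ℝ) (j : Fin r) :
    newtonPolytope (columnForm A j) ⊆ columnFace A j := by
  classical
  refine convexHull_min ?_ (convex_columnFace A j)
  rintro _ ⟨α, hα, rfl⟩
  obtain ⟨k, hk, rfl⟩ := exists_eq_single_of_mem_support_columnForm hα
  have single_eq : (fun i => ((Finsupp.single k 1 : Fin n →₀ ℕ) i : ℝ)) = Pi.single k 1 := by
    ext i
    simp [Finsupp.single_apply, Pi.single_apply, eq_comm]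
  simp only [single_eq]
  refine ⟨single_mem_stdSimplex ℝ k, fun i hi => Pi.single_eq_of_ne ?_ _⟩
  rintro rfl
  exact hk hi

theorem newtonPolytope_columnProduct_subset {n r : ℕ} (A : Matrix (Fin n) (Fin r) ℝ)
    (I : Finset (Fin r)) : newtonPolytope (columnProduct A I) ⊆ ∑ j ∈ I, columnFace A j :=
  (newtonPolytope_prod_subset _ I).trans <|
    Set.finsetSum_subset_finsetSum _ _ _ fun j _ => newtonPolytope_columnForm_subset A j

theorem sum_row_mul_pos {n r : ℕ} {A : Matrix (Fin n) (Fin r) ℝ} (hA : A ∈ shintaniMatrices n r)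
    (i : Fin n) {x : Fin r → ℝ} (hx : ∀ j, 0 < x j) : 0 < ∑ j, A i j * x j := by
  obtain ⟨k, hk⟩ := hA.2.1 i
  exact Finset.sum_pos' (fun j _ => mul_nonneg (hA.1 i j) (hx j).le)
    ⟨k, Finset.mem_univ k, mul_pos hk (hx k)⟩

theorem exists_weights_of_mem_newtonPolytope_add {n r : ℕ} {A : Matrix (Fin n) (Fin r) ℝ}
    (hA : A ∈ shintaniMatrices n r) {σ : Fin n → ℝ}
    (hσ : σ ∈ newtonPolytope (columnProduct A Finset.univ) + positiveOrthant n) :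
    ∃ w : Matrix (Fin n) (Fin r) ℝ, (∀ i j, 0 ≤ w i j) ∧ (∀ i j, A i j = 0 → w i j = 0) ∧
      (∀ j, 1 < ∑ i, w i j) ∧ ∀ i, ∑ j, w i j = σ i := by
  obtain ⟨x, hx, δ, hδ, rfl⟩ := hσ
  obtain ⟨v, hv, rfl⟩ :=
    (Set.mem_fintype_sum _ _).mp (newtonPolytope_columnProduct_subset A _ hx)
  have rowSum_pos (i : Fin n) : 0 < ∑ j, A i j := by
    simpa using sum_row_mul_pos hA i fun _ => one_pos
  have excess_nonneg (i : Fin n) (j : Fin r) : 0 ≤ δ i * (A i j / ∑ l, A i l) :=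
    mul_nonneg (hδ i).le (div_nonneg (hA.1 i j) (rowSum_pos i).le)
  refine ⟨fun i j => v j i + δ i * (A i j / ∑ l, A i l), fun i j => ?_, fun i j hij => ?_,
    fun j => ?_, fun i => ?_⟩
  · exact add_nonneg ((hv j).1.1 i) (excess_nonneg i j)
  · simp [hij, (hv j).2 i hij]
  · obtain ⟨k, hk⟩ := hA.2.2 j
    rw [Finset.sum_add_distrib, (hv j).1.2]
    exact lt_add_of_pos_right _ <| Finset.sum_pos' (fun i _ => excess_nonneg i j)
      ⟨k, Finset.mem_univ k, mul_pos (hδ k) (div_pos hk (rowSum_pos k))⟩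
  · rw [Finset.sum_add_distrib, ← Finset.mul_sum, ← Finset.sum_div, div_self (rowSum_pos i).ne',
      mul_one, ← Finset.sum_apply]
    rfl

theorem prod_rpow_le_sum_rpow_sum {κ : Type*} [Fintype κ] {y w : κ → ℝ} (hy : ∀ j, 0 ≤ y j)
    (hw : ∀ j, 0 ≤ w j) : ∏ j, y j ^ w j ≤ (∑ j, y j) ^ ∑ j, w j := by
  rw [Real.rpow_sum_of_nonneg (Finset.sum_nonneg fun j _ => hy j) fun j _ => hw j]
  refine Finset.prod_le_prod (fun j _ => Real.rpow_nonneg (hy j) _) fun j _ => ?_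
  exact Real.rpow_le_rpow (hy j) (Finset.single_le_sum (fun l _ => hy l) (Finset.mem_univ j)) (hw j)

theorem sum_rpow_neg_sum_le_prod_rpow_neg {κ : Type*} [Fintype κ] {y w : κ → ℝ}
    (hy : ∀ j, 0 ≤ y j) (hw : ∀ j, 0 ≤ w j) (hyw : ∀ j, y j = 0 → w j = 0) :
    (∑ j, y j) ^ (-∑ j, w j) ≤ ∏ j, y j ^ (-w j) := by
  have prod_pos : 0 < ∏ j, y j ^ w j := Finset.prod_pos fun j _ =>
    (hy j).eq_or_lt.elim (fun h => by simp [hyw j h.symm]) fun h => Real.rpow_pos_of_pos h _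
  simp only [Real.rpow_neg (hy _), Real.rpow_neg (Finset.sum_nonneg fun j _ => hy j),
    Finset.prod_inv_distrib]
  exact inv_anti₀ prod_pos (prod_rpow_le_sum_rpow_sum hy hw)

theorem prod_linearForm_rpow_neg_le {ι κ : Type*} [Fintype ι] [Fintype κ] {A w : Matrix ι κ ℝ}
    (hA : ∀ i j, 0 ≤ A i j) (hw : ∀ i j, 0 ≤ w i j) (hAw : ∀ i j, A i j = 0 → w i j = 0)
    {x : κ → ℝ} (hx : ∀ j, 0 < x j) :
    ∏ i, (∑ j, A i j * x j) ^ (-∑ j, w i j) ≤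
      (∏ i, ∏ j, A i j ^ (-w i j)) * ∏ j, x j ^ (-∑ i, w i j) :=
  calc ∏ i, (∑ j, A i j * x j) ^ (-∑ j, w i j)
      ≤ ∏ i, ∏ j, (A i j * x j) ^ (-w i j) := by
        have hAx (i : ι) (j : κ) : 0 ≤ A i j * x j := mul_nonneg (hA i j) (hx j).le
        refine Finset.prod_le_prod
          (fun i _ => Real.rpow_nonneg (Finset.sum_nonneg fun j _ => hAx i j) _)
          fun i _ => sum_rpow_neg_sum_le_prod_rpow_neg (hAx i) (hw i) fun j h => hAw i j ?_
        exact (mul_eq_zero.mp h).resolve_right (hx j).ne'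
    _ = (∏ i, ∏ j, A i j ^ (-w i j)) * ∏ i, ∏ j, x j ^ (-w i j) := by
        simp only [Real.mul_rpow (hA _ _) (hx _).le, Finset.prod_mul_distrib]
    _ = (∏ i, ∏ j, A i j ^ (-w i j)) * ∏ j, x j ^ (-∑ i, w i j) := by
        rw [Finset.prod_comm (f := fun i j => x j ^ (-w i j))]
        simp only [← Finset.sum_neg_distrib, Real.rpow_sum_of_pos (hx _)]

theorem summable_pi_prod {ι : Type*} [Fintype ι] {κ : ι → Type*} {f : ∀ j, κ j → ℝ}
    (hf₀ : ∀ j k, 0 ≤ f j k) (hf : ∀ j, Summable (f j)) :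
    Summable fun m : ∀ j, κ j => ∏ j, f j (m j) := by
  classical
  refine summable_of_sum_le (c := ∏ j, ∑' k, f j k)
    (fun m => Finset.prod_nonneg fun j _ => hf₀ j _) fun u => ?_
  calc ∑ m ∈ u, ∏ j, f j (m j)
      ≤ ∑ m ∈ Fintype.piFinset fun j => u.image fun m => m j, ∏ j, f j (m j) :=
        Finset.sum_le_sum_of_subset_of_nonneg
          (fun m hm => Fintype.mem_piFinset.mpr fun j => Finset.mem_image_of_mem _ hm)
          fun m _ _ => Finset.prod_nonneg fun j _ => hf₀ j _
    _ = ∏ j, ∑ k ∈ u.image fun m => m j, f j k := (Finset.prod_univ_sum _ _).symm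
    _ ≤ ∏ j, ∑' k, f j k := Finset.prod_le_prod
        (fun j _ => Finset.sum_nonneg fun k _ => hf₀ j k)
        fun j _ => (hf j).sum_le_tsum _ fun k _ => hf₀ j k

theorem summable_pi_prod_rpow_neg {κ : Type*} [Fintype κ] {t : κ → ℝ} (ht : ∀ j, 1 < t j) :
    Summable fun m : κ → ℕ+ => ∏ j, ((m j : ℕ) : ℝ) ^ (-t j) :=
  summable_pi_prod (f := fun j (k : ℕ+) => ((k : ℕ) : ℝ) ^ (-t j))
    (fun _ _ => Real.rpow_nonneg (Nat.cast_nonneg _) _) fun j =>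
      (Real.summable_nat_rpow.mpr (neg_lt_neg (ht j))).comp_injective PNat.coe_injective

theorem summable_prod_linearForm_rpow_neg {ι κ : Type*} [Fintype ι] [Fintype κ]
    {A w : Matrix ι κ ℝ} (hA : ∀ i j, 0 ≤ A i j) (hw : ∀ i j, 0 ≤ w i j)
    (hAw : ∀ i j, A i j = 0 → w i j = 0) (hcol : ∀ j, 1 < ∑ i, w i j) :
    Summable fun m : κ → ℕ+ => ∏ i, (∑ j, A i j * ((m j : ℕ) : ℝ)) ^ (-∑ j, w i j) :=
  .of_nonneg_of_le
    (fun _ => Finset.prod_nonneg fun i _ => Real.rpow_nonneg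
      (Finset.sum_nonneg fun j _ => mul_nonneg (hA i j) (Nat.cast_nonneg _)) _)
    (fun m => prod_linearForm_rpow_neg_le hA hw hAw fun j => Nat.cast_pos.mpr (m j).pos)
    ((summable_pi_prod_rpow_neg hcol).mul_left _)

theorem norm_shintaniTerm {n r : ℕ} {A : Matrix (Fin n) (Fin r) ℝ}
    (hA : A ∈ shintaniMatrices n r) (s : Fin n → ℂ) (m : Fin r → ℕ+) :
    ‖shintaniTerm A s m‖ = ∏ i, (∑ j, A i j * ((m j : ℕ) : ℝ)) ^ (-(s i).re) := by
  rw [shintaniTerm, norm_prod]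
  refine Finset.prod_congr rfl fun i _ => ?_
  rw [Complex.norm_cpow_eq_rpow_re_of_pos, Complex.neg_re]
  exact sum_row_mul_pos hA i fun j => Nat.cast_pos.mpr (m j).pos

theorem mainTheorem8 (n r : ℕ) (A : Matrix (Fin n) (Fin r) ℝ) (hA : A ∈ shintaniMatrices n r)
    (s : Fin n → ℂ)
    (hs : (fun i => (s i).re) ∈
      ⋂ I : Finset (Fin r), (newtonPolytope (columnProduct A I) + positiveOrthant n)) :
    Summable (fun m : Fin r → ℕ+ => ‖shintaniTerm A s m‖) := by
  obtain ⟨w, hw, hAw, hcol, hrow⟩ :=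
    exists_weights_of_mem_newtonPolytope_add hA (Set.mem_iInter.mp hs Finset.univ)
  simp only [norm_shintaniTerm hA, ← hrow]
  exact summable_prod_linearForm_rpow_neg hA.1 hw hAw hcol
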